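/- Let $q>1$ be real, let $$E_q(z)=\sum_{n\ge 0}\frac{z^n}{q^{n(n-1)/2}}\quad(z\in\mathbb C),\qquad \Theta_q(z)=\sum_{n\in\mathbb Z}\frac{z^n}{q^{n(n-1)/2}}\quad(z\in\mathbb C\setminus\{0\}),$$ and call $\alpha\in\mathbb R$ *admissible* if there is $K>0$ with $|E_q(z)|\le K\exp\!\big(\tfrac{\log^2|z|}{2\log q}\big)|z|^{\alpha}$ for all $z\ne 0$. For $f$ holomorphic near $0$ put $$\tilde D_qf(z)=\frac{f(qz)-f(0)}{qz},\qquad D_{0,q}f(z)=\frac{f(0\cdot z)-f(qz)}{0\cdot z-qz}\qquad(z\neq 0),$$ extended to $z=0$ by their limit $f'(0)$. For the sequence $m_1(n)=q^{n(n-1)/2}$ let $\partial_{m_1,z}$ be the moment derivative $\partial_{m_1,z}\big(\sum_{n\ge0} a_nz^n\big)=\sum_{n\ge0}\frac{m_1(n+1)}{m_1(n)}a_{n+1}z^n$, acting on Maclaurin series. Then admissible $\alpha$ exist. Moreover, let $\alpha$ be admissible, $r>0$, $f$ holomorphic on $D(0,r)=\{|z|<r\}$, $0<\varepsilon<r$,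 $k\in\mathbb N_0$ and $$|z|<q^{-k}\varepsilon\min\{1,q^{\frac12-\alpha}\}.$$ For $|\omega|=\varepsilon$ choose a direction $\theta=\theta(\omega)\in\mathbb R$ in any way such that $\arg(\omega)+\theta\not\equiv\pi \pmod{2\pi}$ for all $\omega$ on the circle with at most countably many exceptions (for instance a constant $\theta$, for which there is exactly one exception), and let $L_\theta=[0,\infty)e^{i\theta}$. Then the Maclaurin series obtained by applying $\partial_{m_1,z}^k$ to that of $f$ converges absolutely at $z$, and its sum $\partial_{m_1,z}^kf(z)$ satisfies $$\tilde D_q^kf(z)=D_{0,q}^kf(z)=\partial_{m_1,z}^kf(z)=\frac{q}{2\pi i\log q}\oint_{|\omega|=\varepsilon}f(\omega)\int_{L_\theta}\zeta^k\,\frac{E_q(z\zeta)}{\Theta_q(q\omega\zeta)}\,d\zeta\,d\omega,$$ where the inner integral converges absolutely for every non-exceptional $\omega$ and the outer integrand is integrable on the circle. -/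

import Mathlib

noncomputable section

/-- The entire function `E_q(z) = ∑_{n ≥ 0} z^n / q^{n(n-1)/2}`. -/
def qExpE (q : ℝ) (z : ℂ) : ℂ :=
  ∑' n : ℕ, z ^ n / (q : ℂ) ^ (n * (n - 1) / 2)

/-- The Jacobi Theta function `Θ_q(z) = ∑_{n ∈ ℤ} z^n / q^{n(n-1)/2}` (for `z ≠ 0`).
The integer division is exact. -/
def jacobiThetaQ (q : ℝ) (z : ℂ) : ℂ :=
  ∑' n : ℤ, z ^ n / (q : ℂ) ^ (n * (n - 1) / 2)

/-- `α` is an admissible exponent in the growth bound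
`|E_q(z)| ≤ K exp(log²|z| / (2 log q)) |z|^α`. -/
def IsGrowthExponent (q α : ℝ) : Prop :=
  ∃ K : ℝ, 0 < K ∧ ∀ z : ℂ, z ≠ 0 →
    ‖qExpE q z‖ ≤ K * Real.exp (Real.log ‖z‖ ^ 2 / (2 * Real.log q)) * ‖z‖ ^ α

/-- The sequence `m₁(n) = q^{n(n-1)/2}`. -/
def mOne (q : ℝ) (n : ℕ) : ℝ := q ^ (n * (n - 1) / 2)

/-- The formal moment derivative
`∂_m (∑ a_n z^n) = ∑ (m(n+1)/m(n)) a_{n+1} z^n`. -/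
def momentDeriv (m : ℕ → ℝ) (φ : PowerSeries ℂ) : PowerSeries ℂ :=
  PowerSeries.mk fun n => ((m (n + 1) / m n : ℝ) : ℂ) * PowerSeries.coeff (n + 1) φ

/-- The Maclaurin series of a function. -/
def maclaurin (f : ℂ → ℂ) : PowerSeries ℂ :=
  PowerSeries.mk fun n => iteratedDeriv n f 0 / (n.factorial : ℂ)

/-- `D̃_q f(z) = (f(qz) - f(0)) / (qz)`; the value at `z = 0` is the limit `f'(0)`. -/
def tildeD (q : ℝ) (f : ℂ → ℂ) (z : ℂ) : ℂ :=
  if z = 0 then deriv f 0 else (f (q * z) - f 0) / (q * z)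

/-- The `(p,q)`-derivative `D_{p,q} f(z) = (f(pz) - f(qz)) / (pz - qz)`, `p ≠ q`;
the value at `z = 0` is the limit `f'(0)`. -/
def pqDeriv (p q : ℝ) (f : ℂ → ℂ) (z : ℂ) : ℂ :=
  if z = 0 then deriv f 0 else (f (p * z) - f (q * z)) / (p * z - q * z)

/-- Absolute convergence of the integral of `g` along the ray `L_θ = [0,∞) e^{iθ}`. -/
def RayIntegrable (θ : ℝ) (g : ℂ → ℂ) : Prop :=
  MeasureTheory.IntegrableOn
    (fun t : ℝ => g (t * Complex.exp (θ * Complex.I)) * Complex.exp (θ * Complex.I))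
    (Set.Ioi 0)

/-- The integral `∫_{L_θ} g(ζ) dζ` along the ray `L_θ = [0,∞) e^{iθ}`. -/
def rayIntegral (θ : ℝ) (g : ℂ → ℂ) : ℂ :=
  ∫ t in Set.Ioi (0 : ℝ),
    g (t * Complex.exp (θ * Complex.I)) * Complex.exp (θ * Complex.I)

/-- `arg ω + θ ≠ ±π`, read modulo `2π`: the ray `ω L_θ` is not the negative real axis. -/
def AdmissibleDirection (ω : ℂ) (θ : ℝ) : Prop :=
  ∀ n : ℤ, Complex.arg ω + θ ≠ (2 * n + 1) * Real.pi

/-- The kernel `ζ ↦ ζ^k E_q(zζ) / Θ_q(qωζ)`. -/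
def qKernel (q : ℝ) (k : ℕ) (z ω ζ : ℂ) : ℂ :=
  ζ ^ k * (qExpE q (z * ζ) / jacobiThetaQ q (q * ω * ζ))

/-- The right-hand side
`q / (2 log(q) π i) ∮_{|ω|=ε} f(ω) ∫_{L_θ} ζ^k E_q(zζ)/Θ_q(qωζ) dζ dω`,
where the direction `θ = θ(ω)` of the ray may depend on `ω`. -/
def qIntegralRep (q : ℝ) (k : ℕ) (ε : ℝ) (θ : ℂ → ℝ) (f : ℂ → ℂ) (z : ℂ) : ℂ :=
  (q : ℂ) / (2 * (Real.log q : ℂ) * (Real.pi : ℂ) * Complex.I) *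
    ∮ ω in C(0, ε), f ω * rayIntegral (θ ω) (qKernel q k z ω)

end

/-! The inner integral is, up to a constant, a Cauchy kernel; the rest is a comparison of power
series.

Shifting the summation index gives `Θ(q^j z) = q^(j(j+1)/2) z^j Θ(z)`. Cut `∫₀^∞ t^n / Θ(ct) dt` at
the points `q^j` and pull each piece back to `(1, q]`: the sum over `j` is again a theta series, it
cancels `1 / Θ`, and what remains is `∫₁^q ds / s = log q`. So the moments are `q^(n(n+1)/2)
c^(-n-1) log q` (`integral_pow_mul_of_quasiPeriodic`). This needs `Θ` to have no zero on the ray,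
which the Jacobi triple product supplies (`jacobiThetaQ_ne_zero`).

Expanding `E_q` termwise, its coefficients `q^(-n(n-1)/2)` cancel the quadratic growth of the
moments and leave a geometric series in `q^k z / ω`, convergent because `q^k |z| < |ω|`
(`rayIntegral_qKernel`). Cauchy's formula turns the outer integral into `q^(k(k-1)/2) ∑ a_(n+k) (q^k
z)^n`, with `a_n` the Maclaurin coefficients of `f`. This is the `k`-th moment derivative, and the
difference quotients have the same expansion. -/

open Filter Topology MeasureTheory

/-! ### Theta series: quasi-periodicity, convergence, continuity -/

section Theta

/-- The general term `x ^ m / q ^ (m (m - 1) / 2)` of the theta series. -/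
def thetaTerm {K : Type*} [Field K] (q x : K) (m : ℤ) : K := x ^ m / q ^ (m * (m - 1) / 2)

/-- Clears the integer division, so identities between exponents become accessible to linear
arithmetic. -/
theorem two_mul_triangular (m : ℤ) : 2 * (m * (m - 1) / 2) = m * (m - 1) :=
  Int.mul_ediv_cancel' (Int.even_mul_pred_self m).two_dvd

theorem two_mul_triangular_nat (n : ℕ) : 2 * ((n * (n - 1) / 2 : ℕ) : ℤ) = n * (n - 1) := by
  rw [← two_mul_triangular]
  rcases n with _ | n
  · simp
  · push_cast
    simp

theorem thetaTerm_natCast {K : Type*} [Field K] (q x : K) (n : ℕ) :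
    thetaTerm q x n = x ^ n / q ^ (n * (n - 1) / 2) := by
  have h : ((n : ℤ) * (n - 1) / 2) = ((n * (n - 1) / 2 : ℕ) : ℤ) := by
    have := two_mul_triangular n
    have := two_mul_triangular_nat n
    omega
  rw [thetaTerm, h, zpow_natCast, zpow_natCast]

theorem jacobiThetaQ_eq (q : ℝ) (z : ℂ) : jacobiThetaQ q z = ∑' m : ℤ, thetaTerm (q : ℂ) z m := rfl

theorem qExpE_eq (q : ℝ) (z : ℂ) : qExpE q z = ∑' n : ℕ, thetaTerm (q : ℂ) z n := by
  simp only [qExpE, thetaTerm_natCast]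

section Algebra

variable {K : Type*} [Field K] {q x : K}

theorem thetaTerm_ne_zero (hq : q ≠ 0) (hx : x ≠ 0) (m : ℤ) : thetaTerm q x m ≠ 0 :=
  div_ne_zero (zpow_ne_zero _ hx) (zpow_ne_zero _ hq)

theorem thetaTerm_mul (q x y : K) (m : ℤ) : thetaTerm q (y * x) m = y ^ m * thetaTerm q x m := by
  rw [thetaTerm, thetaTerm, mul_zpow, mul_div_assoc]

/-- The quasi-periodicity of the theta series, term by term. -/
theorem thetaTerm_neg_mul_shift (hq : q ≠ 0) (hx : x ≠ 0) (j m : ℤ) :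
    thetaTerm q x (-j) * thetaTerm q (q ^ j * x) m = thetaTerm q x (m - j) := by
  have h : (m - j) * (m - j - 1) / 2 = m * (m - 1) / 2 + (-j) * (-j - 1) / 2 - j * m := by
    have h1 := two_mul_triangular (m - j)
    have h2 := two_mul_triangular m
    have h3 := two_mul_triangular (-j)
    linarith
  rw [thetaTerm_mul]
  simp only [thetaTerm]
  rw [h, zpow_sub₀ hq, zpow_add₀ hq, sub_eq_add_neg m j, zpow_add₀ hx, ← zpow_mul]
  have := zpow_ne_zero (m * (m - 1) / 2) hq
  have := zpow_ne_zero ((-j) * (-j - 1) / 2) hq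
  have := zpow_ne_zero (j * m) hq
  field_simp

theorem thetaTerm_succ (hq : q ≠ 0) (hx : x ≠ 0) (m : ℤ) :
    thetaTerm q x (m + 1) = x / q ^ m * thetaTerm q x m := by
  have h : (m + 1) * (m + 1 - 1) / 2 = m * (m - 1) / 2 + m := by
    have h1 := two_mul_triangular (m + 1)
    have h2 := two_mul_triangular m
    linarith
  simp only [thetaTerm]
  rw [h, zpow_add₀ hq, zpow_add₀ hx, zpow_one]
  have := zpow_ne_zero (m * (m - 1) / 2) hq
  field_simp

/-- The reflection `m ↦ 1 - m` fixes `m (m - 1) / 2`; it reduces summability over negative indices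
to positive ones. -/
theorem thetaTerm_one_sub (hx : x ≠ 0) (m : ℤ) :
    thetaTerm q x (1 - m) = x * thetaTerm q x⁻¹ m := by
  have h : (1 - m) * (1 - m - 1) / 2 = m * (m - 1) / 2 := by
    congr 1
    ring
  simp only [thetaTerm]
  rw [h, zpow_sub₀ hx, zpow_one, inv_zpow]
  ring

end Algebra

theorem norm_thetaTerm {q : ℝ} (hq : 0 < q) (z : ℂ) (m : ℤ) :
    ‖thetaTerm (q : ℂ) z m‖ = thetaTerm q ‖z‖ m := by
  simp [thetaTerm, abs_of_pos hq]

theorem ofReal_thetaTerm (q x : ℝ) (m : ℤ) :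
    ((thetaTerm q x m : ℝ) : ℂ) = thetaTerm (q : ℂ) x m := by
  simp [thetaTerm]

theorem thetaTerm_nonneg {q x : ℝ} (hq : 0 < q) (hx : 0 ≤ x) (m : ℤ) : 0 ≤ thetaTerm q x m := by
  unfold thetaTerm
  positivity

theorem summable_thetaTerm_nat {q x : ℝ} (hq : 1 < q) (hx : 0 < x) :
    Summable fun n : ℕ => thetaTerm q x n := by
  have hq0 : q ≠ 0 := by positivity
  refine summable_of_ratio_test_tendsto_lt_one (l := 0) one_pos
    (Eventually.of_forall fun n => thetaTerm_ne_zero hq0 hx.ne' _) ?_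
  have h : ∀ n : ℕ, ‖thetaTerm q x ((n + 1 : ℕ) : ℤ)‖ / ‖thetaTerm q x n‖ = x * (q⁻¹) ^ n := by
    intro n
    push_cast
    rw [thetaTerm_succ hq0 hx.ne', norm_mul, mul_div_assoc,
      div_self (norm_ne_zero_iff.2 (thetaTerm_ne_zero hq0 hx.ne' _)), mul_one,
      Real.norm_of_nonneg (by positivity), zpow_natCast, inv_pow, div_eq_mul_inv]
  simp only [h]
  simpa using (tendsto_pow_atTop_nhds_zero_of_lt_one (by positivity)
    (inv_lt_one_of_one_lt₀ hq)).const_mul x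

theorem summable_thetaTerm {q x : ℝ} (hq : 1 < q) (hx : 0 < x) :
    Summable fun m : ℤ => thetaTerm q x m := by
  refine Summable.of_nat_of_neg_add_one (summable_thetaTerm_nat hq hx) ?_
  have h : ∀ n : ℕ, thetaTerm q x (-(n + 1 : ℤ)) = x * thetaTerm q x⁻¹ ((n + 2 : ℕ) : ℤ) := by
    intro n
    rw [← thetaTerm_one_sub hx.ne']
    congr 1
  simp only [h]
  exact ((summable_nat_add_iff 2).2 (summable_thetaTerm_nat hq (inv_pos.2 hx))).mul_left x

theorem summable_norm_thetaTerm {q : ℝ} (hq : 1 < q) {z : ℂ} (hz : z ≠ 0) :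
    Summable fun m : ℤ => ‖thetaTerm (q : ℂ) z m‖ := by
  simp only [norm_thetaTerm (zero_lt_one.trans hq)]
  exact summable_thetaTerm hq (norm_pos_iff.2 hz)

theorem summable_thetaTerm_complex {q : ℝ} (hq : 1 < q) {z : ℂ} (hz : z ≠ 0) :
    Summable fun m : ℤ => thetaTerm (q : ℂ) z m :=
  (summable_norm_thetaTerm hq hz).of_norm

/-- On an annulus the theta terms are dominated by those at the two boundary radii. -/
theorem thetaTerm_le_add {q a b x : ℝ} (hq : 0 < q) (ha : 0 < a) (hax : a ≤ x) (hxb : x ≤ b)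
    (m : ℤ) : thetaTerm q x m ≤ thetaTerm q a m + thetaTerm q b m := by
  have hx := ha.trans_le hax
  have hb := hx.trans_le hxb
  rcases le_total 0 m with hm | hm
  · refine le_add_of_nonneg_of_le (thetaTerm_nonneg hq ha.le m) ?_
    unfold thetaTerm
    have h : x ^ m ≤ b ^ m := zpow_le_zpow_left₀ hm hx.le hxb
    gcongr
  · refine le_add_of_le_of_nonneg ?_ (thetaTerm_nonneg hq hb.le m)
    unfold thetaTerm
    obtain ⟨n, rfl⟩ := Int.eq_ofNat_of_zero_le (neg_nonneg.2 hm) |>.imp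
      fun n h => neg_eq_iff_eq_neg.1 h
    have h : x ^ (-(n : ℤ)) ≤ a ^ (-(n : ℤ)) := by
      rw [zpow_neg, zpow_neg, zpow_natCast, zpow_natCast]
      gcongr
    gcongr

theorem thetaTerm_neg_mul_jacobiThetaQ {q : ℝ} (hq : 1 < q) {z : ℂ} (hz : z ≠ 0) (j : ℤ) :
    thetaTerm (q : ℂ) z (-j) * jacobiThetaQ q ((q : ℂ) ^ j * z) = jacobiThetaQ q z := by
  have hq0 : (q : ℂ) ≠ 0 := by exact_mod_cast (zero_lt_one.trans hq).ne'
  rw [jacobiThetaQ_eq, jacobiThetaQ_eq, ← tsum_mul_left]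
  simp only [thetaTerm_neg_mul_shift hq0 hz]
  exact (Equiv.subRight j).tsum_eq fun m => thetaTerm (q : ℂ) z m

theorem continuousOn_jacobiThetaQ {q : ℝ} (hq : 1 < q) : ContinuousOn (jacobiThetaQ q) {0}ᶜ := by
  have hq0 := zero_lt_one.trans hq
  have key : ∀ a b : ℝ, 0 < a → a ≤ b →
      ContinuousOn (jacobiThetaQ q) {z | a ≤ ‖z‖ ∧ ‖z‖ ≤ b} := by
    intro a b ha hab
    refine continuousOn_tsum (u := fun m => thetaTerm q a m + thetaTerm q b m) ?_
      ((summable_thetaTerm hq ha).add (summable_thetaTerm hq (ha.trans_le hab))) ?_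
    · intro m z hz
      have : z ≠ 0 := norm_pos_iff.1 (ha.trans_le hz.1)
      exact ((continuousAt_zpow₀ z m (Or.inl this)).div_const _).continuousWithinAt
    · intro m z hz
      have := norm_thetaTerm hq0 z m
      rw [thetaTerm] at this
      rw [this]
      exact thetaTerm_le_add hq0 ha hz.1 hz.2 m
  intro z hz
  have hz' : 0 < ‖z‖ := norm_pos_iff.2 hz
  refine ContinuousAt.continuousWithinAt ((key (‖z‖ / 2) (2 * ‖z‖) (by positivity)
    (by linarith)).continuousAt ?_)
  have h1 : ∀ᶠ w in 𝓝 z, ‖z‖ / 2 < ‖w‖ :=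
    continuous_norm.continuousAt.eventually (lt_mem_nhds (half_lt_self hz'))
  have h2 : ∀ᶠ w in 𝓝 z, ‖w‖ < 2 * ‖z‖ :=
    continuous_norm.continuousAt.eventually (gt_mem_nhds (by linarith))
  filter_upwards [h1, h2] with w hw1 hw2 using ⟨hw1.le, hw2.le⟩

end Theta

/-! ### Jacobi triple product and the zeros of theta -/

section TripleProduct

/-- `∏_{i < n} (1 - p ^ (i + 1))`. -/
noncomputable def eulerProd (p : ℂ) (n : ℕ) : ℂ := ∏ i ∈ Finset.range n, (1 - p ^ (i + 1))

/-- The reciprocal of `eulerProd`, extended by zero to negative indices. -/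
noncomputable def invEulerProd (p : ℂ) : ℤ → ℂ
  | Int.ofNat n => (eulerProd p n)⁻¹
  | Int.negSucc _ => 0

theorem one_sub_pow_ne_zero {p : ℂ} (hp : ‖p‖ < 1) (n : ℕ) : 1 - p ^ (n + 1) ≠ 0 := by
  intro h
  have h1 : ‖p ^ (n + 1)‖ = 1 := by rw [← sub_eq_zero.1 h, norm_one]
  rw [norm_pow] at h1
  exact (pow_lt_one₀ (norm_nonneg _) hp n.succ_ne_zero).ne h1

/-- The extension by zero keeps the recursion valid at every integer: at `m = 0` the factor `1 - p ^
0` vanishes. -/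
theorem invEulerProd_sub_one {p : ℂ} (hp : ‖p‖ < 1) (m : ℤ) :
    invEulerProd p (m - 1) = (1 - p ^ m) * invEulerProd p m := by
  rcases m with (_ | n) | n
  · have h : Int.ofNat 0 - 1 = Int.negSucc 0 := rfl
    rw [h]
    simp [invEulerProd]
  · have h : Int.ofNat (n + 1) - 1 = Int.ofNat n := by simp
    rw [h]
    simp only [invEulerProd, Int.ofNat_eq_natCast, zpow_natCast, eulerProd, Finset.prod_range_succ,
      mul_inv]
    field_simp [one_sub_pow_ne_zero hp n]
  · have h : Int.negSucc n - 1 = Int.negSucc (n + 1) := by omega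
    rw [h]
    simp [invEulerProd]

theorem exists_tendsto_eulerProd {p : ℂ} (hp : ‖p‖ < 1) :
    ∃ T : ℂ, T ≠ 0 ∧ Tendsto (eulerProd p) atTop (𝓝 T) := by
  have hs : Summable fun i : ℕ => ‖-p ^ (i + 1)‖ := by
    simpa using (summable_nat_add_iff 1).2 (summable_geometric_of_lt_one (norm_nonneg _) hp)
  refine ⟨∏' i : ℕ, (1 + -p ^ (i + 1)), tprod_one_add_ne_zero_of_summable
    (fun i => by simpa [← sub_eq_add_neg] using one_sub_pow_ne_zero hp i) hs, ?_⟩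
  have he : eulerProd p = fun n => ∏ i ∈ Finset.range n, (1 + -p ^ (i + 1)) := by
    funext n
    simp [eulerProd, sub_eq_add_neg]
  rw [he]
  exact (multipliable_one_add_of_summable hs).hasProd.tendsto_prod_nat

/-- The finite form of the Jacobi triple product identity. -/
theorem hasSum_finite_tripleProduct {q z : ℂ} (hq : 1 < ‖q‖) (hz : z ≠ 0) (N : ℕ) :
    HasSum (fun m : ℤ => eulerProd q⁻¹ (2 * N) *
        (invEulerProd q⁻¹ (N + m) * invEulerProd q⁻¹ (N - m)) * thetaTerm q z m)
      (∏ j ∈ Finset.range N, ((1 + z * q⁻¹ ^ j) * (1 + z⁻¹ * q⁻¹ ^ (j + 1)))) := by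
  have hq0 : q ≠ 0 := norm_pos_iff.1 (zero_lt_one.trans hq)
  have hp : ‖q⁻¹‖ < 1 := by simpa using inv_lt_one_of_one_lt₀ hq
  induction N with
  | zero =>
    have : ∀ m : ℤ, m ≠ 0 → eulerProd q⁻¹ (2 * 0) *
        (invEulerProd q⁻¹ ((0 : ℕ) + m) * invEulerProd q⁻¹ ((0 : ℕ) - m)) * thetaTerm q z m = 0 := by
      rintro ((_ | n) | n) hm
      · exact absurd rfl hm
      · have h : ((0 : ℕ) : ℤ) - Int.ofNat (n + 1) = Int.negSucc n := by
          simp only [Int.ofNat_eq_natCast]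
          omega
        rw [h]
        simp [invEulerProd]
      · simp [invEulerProd]
    simpa [eulerProd, invEulerProd, thetaTerm] using hasSum_single (0 : ℤ) this
  | succ N ih =>
    -- The new factor of the product has four monomials: `z` shifts the series up, `z⁻¹` shifts it
    -- down, and the other two do not shift it.
    have up := ((Equiv.subRight (1 : ℤ)).hasSum_iff.2 ih).mul_left (z * q⁻¹ ^ N)
    have down := ((Equiv.addRight (1 : ℤ)).hasSum_iff.2 ih).mul_left (z⁻¹ * q⁻¹ ^ (N + 1))
    have mid := ih.mul_left (1 + q⁻¹ ^ (2 * N + 1))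
    convert! (mid.add up).add down using 1
    · funext m
      simp only [Function.comp_apply, Equiv.subRight_apply, Equiv.coe_addRight]
      have e0 : eulerProd q⁻¹ (2 * (N + 1)) =
          eulerProd q⁻¹ (2 * N) * (1 - q⁻¹ ^ (2 * N + 1)) * (1 - q⁻¹ ^ (2 * N + 2)) := by
        rw [show 2 * (N + 1) = 2 * N + 1 + 1 by ring, eulerProd, Finset.prod_range_succ,
          Finset.prod_range_succ]
        rfl
      -- Writing all reciprocal products through those at `N + 1 ± m` turns the coefficient
      -- recursion into a polynomial identity in `u`, `v`, `q`.
      set u := q⁻¹ ^ ((N : ℤ) + 1 + m) with hu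
      set v := q⁻¹ ^ ((N : ℤ) + 1 - m) with hv
      have a1 : invEulerProd q⁻¹ (N + m) = (1 - u) * invEulerProd q⁻¹ (N + 1 + m) := by
        rw [← invEulerProd_sub_one hp]; congr 1; ring
      have a2 : invEulerProd q⁻¹ (N - m) = (1 - v) * invEulerProd q⁻¹ (N + 1 - m) := by
        rw [← invEulerProd_sub_one hp]; congr 1; ring
      have hpz : q⁻¹ ≠ 0 := inv_ne_zero hq0
      have hu' : q⁻¹ ^ ((N : ℤ) + m) = u * q := by
        rw [hu, show (N : ℤ) + 1 + m = N + m + 1 by ring, zpow_add₀ hpz _ 1, zpow_one]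
        field_simp
      have hv' : q⁻¹ ^ ((N : ℤ) - m) = v * q := by
        rw [hv, show (N : ℤ) + 1 - m = N - m + 1 by ring, zpow_add₀ hpz _ 1, zpow_one]
        field_simp
      have a3 : invEulerProd q⁻¹ (N + (m - 1)) =
          (1 - u * q) * ((1 - u) * invEulerProd q⁻¹ (N + 1 + m)) := by
        rw [← a1, ← hu', ← invEulerProd_sub_one hp]; congr 1; ring
      have a4 : invEulerProd q⁻¹ (N - (m + 1)) =
          (1 - v * q) * ((1 - v) * invEulerProd q⁻¹ (N + 1 - m)) := by
        rw [← a2, ← hv', ← invEulerProd_sub_one hp]; congr 1; ring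
      have a5 : invEulerProd q⁻¹ (N - (m - 1)) = invEulerProd q⁻¹ (N + 1 - m) := by
        congr 1; ring
      have a6 : invEulerProd q⁻¹ (N + (m + 1)) = invEulerProd q⁻¹ (N + 1 + m) := by
        congr 1; ring
      have t1 : z * q⁻¹ ^ N * thetaTerm q z (m - 1) = v * thetaTerm q z m := by
        have := thetaTerm_succ hq0 hz (m - 1)
        rw [sub_add_cancel] at this
        rw [this, hv, show (N : ℤ) + 1 - m = N - (m - 1) by ring, zpow_sub₀ hpz, zpow_natCast,
          inv_zpow q (m - 1)]
        field_simp
      have t2 : z⁻¹ * q⁻¹ ^ (N + 1) * thetaTerm q z (m + 1) = u * thetaTerm q z m := by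
        rw [thetaTerm_succ hq0 hz, hu, zpow_add₀ hpz, inv_zpow q m]
        have : q⁻¹ ^ ((N : ℤ) + 1) = q⁻¹ ^ (N + 1) := by exact_mod_cast zpow_natCast q⁻¹ (N + 1)
        rw [this]
        field_simp
      have uv : q⁻¹ ^ (2 * N + 2) = u * v := by
        rw [hu, hv, ← zpow_add₀ hpz, ← zpow_natCast]
        congr 1
        push_cast
        ring
      have uv' : q⁻¹ ^ (2 * N + 1) = u * v * q := by
        rw [← uv, pow_succ _ (2 * N + 1), mul_assoc, inv_mul_cancel₀ hq0, mul_one]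
      push_cast
      rw [e0, a1, a2, a3, a4, a5, a6, uv, uv']
      linear_combination (-eulerProd q⁻¹ (2 * N)) * ((1 - u * q) * ((1 - u) *
        invEulerProd q⁻¹ (N + 1 + m))) * invEulerProd q⁻¹ (N + 1 - m) * t1
        - eulerProd q⁻¹ (2 * N) * ((1 - v * q) * ((1 - v) *
        invEulerProd q⁻¹ (N + 1 - m))) * invEulerProd q⁻¹ (N + 1 + m) * t2
    · rw [Finset.prod_range_succ]
      have : (1 + z * q⁻¹ ^ N) * (1 + z⁻¹ * q⁻¹ ^ (N + 1)) =
          1 + q⁻¹ ^ (2 * N + 1) + z * q⁻¹ ^ N + z⁻¹ * q⁻¹ ^ (N + 1) := by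
        field_simp
        ring
      rw [this]
      ring

theorem tendsto_invEulerProd {p T : ℂ} (hT : T ≠ 0) (h : Tendsto (eulerProd p) atTop (𝓝 T)) :
    Tendsto (invEulerProd p) atTop (𝓝 T⁻¹) := by
  have h1 : Tendsto (fun n : ℤ => (eulerProd p n.toNat)⁻¹) atTop (𝓝 T⁻¹) :=
    (h.comp (tendsto_atTop_atTop.2 fun b : ℕ => ⟨(b : ℤ), fun a ha => by omega⟩ :
      Tendsto Int.toNat atTop atTop)).inv₀ hT
  refine h1.congr' ?_
  filter_upwards [eventually_ge_atTop 0] with n hn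
  lift n to ℕ using hn
  rfl

theorem exists_norm_invEulerProd_le {p T : ℂ} (hT : T ≠ 0)
    (h : Tendsto (eulerProd p) atTop (𝓝 T)) : ∃ C, 0 ≤ C ∧ ∀ m, ‖invEulerProd p m‖ ≤ C := by
  obtain ⟨C, hC⟩ := (h.inv₀ hT).norm.bddAbove_range
  refine ⟨max C 0, le_max_right _ _, ?_⟩
  rintro (n | n)
  · exact (hC ⟨n, rfl⟩).trans (le_max_left _ _)
  · simp [invEulerProd]

/-- The theta function has no zeros off the negative real axis. -/
theorem jacobiThetaQ_ne_zero {q : ℝ} (hq : 1 < q) {z : ℂ} (hz : z ≠ 0)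
    (hneg : ∀ x : ℝ, 0 < x → z ≠ -x) : jacobiThetaQ q z ≠ 0 := by
  have hq0 : 0 < q := zero_lt_one.trans hq
  have hqn : 1 < ‖(q : ℂ)‖ := by simpa [abs_of_pos hq0] using hq
  have hp : ‖(q : ℂ)⁻¹‖ < 1 := by simpa using inv_lt_one_of_one_lt₀ hqn
  obtain ⟨T, hT, hlim⟩ := exists_tendsto_eulerProd hp
  obtain ⟨C, hC0, hC⟩ := exists_norm_invEulerProd_le hT hlim
  obtain ⟨C', hC'⟩ := hlim.norm.bddAbove_range
  have hR := tendsto_invEulerProd hT hlim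
  -- Let `N → ∞` in the finite identity: the coefficients are bounded uniformly in `N` and `m`, so
  -- the theta terms dominate.
  have hsum : Tendsto (fun N : ℕ => ∑' m : ℤ, eulerProd (q : ℂ)⁻¹ (2 * N) *
      (invEulerProd (q : ℂ)⁻¹ (N + m) * invEulerProd (q : ℂ)⁻¹ (N - m)) * thetaTerm (q : ℂ) z m)
      atTop (𝓝 (∑' m : ℤ, T * (T⁻¹ * T⁻¹) * thetaTerm (q : ℂ) z m)) := by
    refine tendsto_tsum_of_dominated_convergence
      (bound := fun m => C' * (C * C) * ‖thetaTerm (q : ℂ) z m‖)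
      ((summable_norm_thetaTerm hq hz).mul_left _) ?_ ?_
    · intro m
      have hN : Tendsto (fun N : ℕ => (N : ℤ)) atTop atTop := tendsto_natCast_atTop_atTop
      refine (Tendsto.mul ?_ (Tendsto.mul ?_ ?_)).mul_const _
      · exact hlim.comp (tendsto_id.const_mul_atTop' two_pos)
      · exact hR.comp (tendsto_atTop_add_const_right _ m hN)
      · exact hR.comp (tendsto_atTop_add_const_right _ (-m) hN)
    · refine Eventually.of_forall fun N m => ?_
      rw [norm_mul, norm_mul, norm_mul]
      have h1 : ‖eulerProd (q : ℂ)⁻¹ (2 * N)‖ ≤ C' := hC' ⟨_, rfl⟩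
      have h2 := hC (N + m)
      have h3 := hC (N - m)
      have h4 := (norm_nonneg _).trans h1
      gcongr
  simp only [(hasSum_finite_tripleProduct hqn hz _).tsum_eq, tsum_mul_left,
    Finset.prod_mul_distrib] at hsum
  have hgeo : Summable fun j : ℕ => ‖(q : ℂ)⁻¹ ^ j‖ := by
    simpa using summable_geometric_of_lt_one (norm_nonneg _) hp
  have hs1 : Summable fun j : ℕ => ‖z * (q : ℂ)⁻¹ ^ j‖ := by
    simpa only [norm_mul] using hgeo.mul_left ‖z‖
  have hs2 : Summable fun j : ℕ => ‖z⁻¹ * (q : ℂ)⁻¹ ^ (j + 1)‖ := by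
    simpa only [norm_mul] using ((summable_nat_add_iff 1).2 hgeo).mul_left ‖z⁻¹‖
  have hprod := (multipliable_one_add_of_summable hs1).hasProd.tendsto_prod_nat.mul
    (multipliable_one_add_of_summable hs2).hasProd.tendsto_prod_nat
  have heq := tendsto_nhds_unique hprod hsum
  -- A vanishing factor would force `z = -q^j` here, or `z = -q^(-(j+1))` in the second product.
  have n1 : ∀ j : ℕ, 1 + z * (q : ℂ)⁻¹ ^ j ≠ 0 := by
    intro j h
    refine hneg (q ^ j) (by positivity) ?_
    have hqj : (q : ℂ) ^ j ≠ 0 := pow_ne_zero _ (by exact_mod_cast hq0.ne')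
    push_cast
    rw [inv_pow] at h
    field_simp at h
    linear_combination h
  have n2 : ∀ j : ℕ, 1 + z⁻¹ * (q : ℂ)⁻¹ ^ (j + 1) ≠ 0 := by
    intro j h
    refine hneg ((q ^ (j + 1))⁻¹) (by positivity) ?_
    push_cast
    rw [inv_pow] at h
    have : z * (1 + z⁻¹ * ((q : ℂ) ^ (j + 1))⁻¹) = 0 := by rw [h, mul_zero]
    rw [mul_add, mul_inv_cancel_left₀ hz] at this
    linear_combination this
  intro h0
  rw [← jacobiThetaQ_eq, h0, mul_zero] at heq
  exact mul_ne_zero (tprod_one_add_ne_zero_of_summable n1 hs1)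
    (tprod_one_add_ne_zero_of_summable n2 hs2) heq

end TripleProduct

/-! ### Folding integrals over `(0, ∞)` onto one period -/

section Unfolding

theorem hasSum_thetaTerm_neg {q : ℝ} (hq : 1 < q) {z : ℂ} (hz : z ≠ 0) :
    HasSum (fun j : ℤ => thetaTerm (q : ℂ) z (-j)) (jacobiThetaQ q z) :=
  (Equiv.neg ℤ).hasSum_iff (f := fun m => thetaTerm (q : ℂ) z m) |>.2
    (summable_thetaTerm_complex hq hz).hasSum

theorem summable_thetaTerm_neg {q x : ℝ} (hq : 1 < q) (hx : 0 < x) :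
    Summable fun j : ℤ => thetaTerm q x (-j) :=
  (Equiv.neg ℤ).summable_iff (f := fun m => thetaTerm q x m) |>.2 (summable_thetaTerm hq hx)

theorem iUnion_Ioc_zpow {q : ℝ} (hq : 1 < q) :
    ⋃ j : ℤ, Set.Ioc (q ^ j) (q ^ (j + 1)) = Set.Ioi 0 := by
  ext x
  simp only [Set.mem_iUnion, Set.mem_Ioi]
  refine ⟨fun ⟨j, hj⟩ => (zpow_pos (zero_lt_one.trans hq) j).trans hj.1, fun hx => ?_⟩
  exact exists_mem_Ioc_zpow hx hq

theorem pairwise_disjoint_Ioc_zpow {q : ℝ} (hq : 1 < q) :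
    Pairwise (Function.onFun Disjoint fun j : ℤ => Set.Ioc (q ^ j) (q ^ (j + 1))) :=
  (zpow_right_mono₀ hq.le).pairwise_disjoint_on_Ioc_succ

/-- Integration over `(0, ∞)` by folding onto the fundamental interval `(1, q]` of `t ↦ q t`. -/
theorem integral_Ioi_eq_of_hasSum_fold {q : ℝ} (hq : 1 < q) {F G : ℝ → ℂ} {b : ℤ → ℝ}
    (hF : ContinuousOn F (Set.Ioi 0)) (hb : Summable b)
    (hbound : ∀ j : ℤ, ∀ s ∈ Set.Icc 1 q, ‖(q : ℂ) ^ j * F (q ^ j * s)‖ ≤ b j)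
    (hsum : ∀ s ∈ Set.Icc 1 q, HasSum (fun j : ℤ => (q : ℂ) ^ j * F (q ^ j * s)) (G s)) :
    IntegrableOn F (Set.Ioi 0) ∧ ∫ t in Set.Ioi 0, F t = ∫ s in (1 : ℝ)..q, G s := by
  have hq0 := zero_lt_one.trans hq
  have hpos : ∀ j : ℤ, 0 < q ^ j := fun j => zpow_pos hq0 j
  have hle : ∀ j : ℤ, q ^ j ≤ q ^ (j + 1) := fun j => zpow_le_zpow_right₀ hq.le (by omega)
  have hsub : ∀ j : ℤ, Set.Icc (q ^ j) (q ^ (j + 1)) ⊆ Set.Ioi 0 :=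
    fun j x hx => (hpos j).trans_le hx.1
  have hint : ∀ j : ℤ, IntegrableOn F (Set.Ioc (q ^ j) (q ^ (j + 1))) := fun j =>
    ((hF.mono (hsub j)).integrableOn_Icc).mono_set Set.Ioc_subset_Icc_self
  have hcont : ∀ j : ℤ, ContinuousOn (fun s : ℝ => (q : ℂ) ^ j * F (q ^ j * s)) (Set.Icc 1 q) := by
    intro j
    refine continuousOn_const.mul (hF.comp (by fun_prop) fun s hs => ?_)
    exact mul_pos (hpos j) (zero_lt_one.trans_le hs.1)
  have hpiece : ∀ j : ℤ, ∫ t in Set.Ioc (q ^ j) (q ^ (j + 1)), F t =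
      ∫ s in (1 : ℝ)..q, (q : ℂ) ^ j * F (q ^ j * s) := by
    intro j
    rw [← intervalIntegral.integral_of_le (hle j), intervalIntegral.integral_const_mul]
    have := intervalIntegral.smul_integral_comp_mul_left (a := 1) (b := q) F (q ^ j)
    rw [mul_one, ← zpow_add_one₀ hq0.ne'] at this
    rw [← this, Complex.real_smul]
    push_cast
    rfl
  have hnorm : ∀ j : ℤ, ∫ t in Set.Ioc (q ^ j) (q ^ (j + 1)), ‖F t‖ ≤ b j * (q - 1) := by
    intro j
    rw [← intervalIntegral.integral_of_le (hle j)]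
    have := intervalIntegral.smul_integral_comp_mul_left (a := 1) (b := q) (fun t => ‖F t‖) (q ^ j)
    rw [mul_one, ← zpow_add_one₀ hq0.ne'] at this
    rw [← this, smul_eq_mul, ← intervalIntegral.integral_const_mul]
    have h2 : ∫ s in (1 : ℝ)..q, q ^ j * ‖F (q ^ j * s)‖ ≤ ∫ s in (1 : ℝ)..q, b j := by
      refine intervalIntegral.integral_mono_on hq.le ?_ intervalIntegrable_const ?_
      · refine ContinuousOn.intervalIntegrable ?_
        rw [Set.uIcc_of_le hq.le]
        refine ((hcont j).norm).congr fun s _ => ?_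
        simp [abs_of_pos hq0]
      · intro s hs
        simpa [abs_of_pos hq0] using hbound j s hs
    refine h2.trans_eq ?_
    rw [intervalIntegral.integral_const, smul_eq_mul, mul_comm]
  have hI : IntegrableOn F (Set.Ioi 0) := by
    rw [← iUnion_Ioc_zpow hq]
    refine integrableOn_iUnion_of_summable_integral_norm hint ?_
    exact (hb.mul_right (q - 1)).of_nonneg_of_le
      (fun j => integral_nonneg fun _ => norm_nonneg _) hnorm
  refine ⟨hI, ?_⟩
  have h1 : HasSum (fun j : ℤ => ∫ t in Set.Ioc (q ^ j) (q ^ (j + 1)), F t)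
      (∫ t in Set.Ioi 0, F t) := by
    rw [← iUnion_Ioc_zpow hq] at hI ⊢
    exact hasSum_integral_iUnion (fun _ => measurableSet_Ioc) (pairwise_disjoint_Ioc_zpow hq) hI
  simp only [hpiece] at h1
  have hmem : ∀ s, s ∈ Set.uIoc 1 q → s ∈ Set.Icc 1 q := by
    intro s hs
    rw [Set.uIoc_of_le hq.le] at hs
    exact Set.Ioc_subset_Icc_self hs
  refine h1.unique (intervalIntegral.hasSum_integral_of_dominated_convergence (fun j _ => b j)
    ?_ ?_ ?_ ?_ ?_)
  · intro j
    exact ((hcont j).mono hmem).aestronglyMeasurable measurableSet_uIoc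
  · exact fun j => Eventually.of_forall fun s hs => hbound j s (hmem s hs)
  · exact Eventually.of_forall fun s _ => hb
  · exact intervalIntegrable_const
  · exact Eventually.of_forall fun s hs => hsum s (hmem s hs)

/-- Moments of a function with the quasi-periodicity of `1 / Θ_q(c t)`. -/
theorem integral_pow_mul_of_quasiPeriodic {q : ℝ} (hq : 1 < q) {c : ℂ} (hc : c ≠ 0) {W : ℝ → ℂ}
    (hW : ContinuousOn W (Set.Ioi 0))
    (hqp : ∀ (j : ℤ) (t : ℝ), 0 < t → W (q ^ j * t) = thetaTerm (q : ℂ) (c * t) (-j) * W t)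
    (n : ℕ) :
    IntegrableOn (fun t : ℝ => (t : ℂ) ^ n * W t) (Set.Ioi 0) ∧
      ∫ t in Set.Ioi (0 : ℝ), (t : ℂ) ^ n * W t =
        (q : ℂ) ^ (n * (n + 1) / 2) / c ^ (n + 1) *
          ∫ s in (1 : ℝ)..q, jacobiThetaQ q (c * s) * W s / s := by
  have hq0 := zero_lt_one.trans hq
  have hqc : (q : ℂ) ≠ 0 := by exact_mod_cast hq0.ne'
  -- The Jacobian `q^j` and the factor `(q^j)^n` from `t^n` make `q^(j(n+1))`; rescaling `c` to `d`
  -- absorbs it into the theta term of index `-j`.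
  obtain ⟨d, hd⟩ : ∃ d : ℂ, d = (q : ℂ) ^ (-((n : ℤ) + 1)) * c := ⟨_, rfl⟩
  have hd0 : d ≠ 0 := hd ▸ mul_ne_zero (zpow_ne_zero _ hqc) hc
  have hterm : ∀ (j : ℤ) (s : ℝ), s ∈ Set.Icc 1 q →
      (q : ℂ) ^ j * (((q ^ j * s : ℝ) : ℂ) ^ n * W (q ^ j * s)) =
        thetaTerm (q : ℂ) (d * s) (-j) * ((s : ℂ) ^ n * W s) := by
    intro j s hs
    have hs0 : 0 < s := zero_lt_one.trans_le hs.1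
    rw [hqp j s hs0, hd, mul_assoc _ c, thetaTerm_mul (q : ℂ) (c * s) (_ ^ _)]
    have : ((q : ℂ) ^ (-((n : ℤ) + 1))) ^ (-j) = (q : ℂ) ^ j * ((q : ℂ) ^ j) ^ n := by
      rw [← zpow_natCast ((q : ℂ) ^ j), ← zpow_mul, ← zpow_mul, ← zpow_add₀ hqc]
      congr 1
      ring
    rw [this]
    push_cast
    ring
  have hcont : ContinuousOn (fun t : ℝ => (t : ℂ) ^ n * W t) (Set.Ioi 0) :=
    (Continuous.continuousOn (by fun_prop)).mul hW
  obtain ⟨M, hM⟩ := isCompact_Icc.exists_bound_of_continuousOn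
    (hcont.mono (fun s (hs : s ∈ Set.Icc 1 q) => zero_lt_one.trans_le hs.1))
  have hdn : 0 < ‖d‖ := norm_pos_iff.2 hd0
  have key := integral_Ioi_eq_of_hasSum_fold hq
    (F := fun t : ℝ => (t : ℂ) ^ n * W t)
    (G := fun s : ℝ => jacobiThetaQ q (d * s) * ((s : ℂ) ^ n * W s))
    (b := fun j => (thetaTerm q ‖d‖ (-j) + thetaTerm q (‖d‖ * q) (-j)) * M) hcont
    ?_ ?_ ?_
  · refine ⟨key.1, key.2.trans ?_⟩
    rw [← intervalIntegral.integral_const_mul]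
    refine intervalIntegral.integral_congr fun s hs => ?_
    rw [Set.uIcc_of_le hq.le] at hs
    have hs0 : (s : ℂ) ≠ 0 := by exact_mod_cast (zero_lt_one.trans_le hs.1).ne'
    -- Quasi-periodicity with shift `n + 1` returns from `d` to `c`; its factor contains `s^(-n-1)`,
    -- which against `s^n` leaves `1 / s`.
    have h1 := thetaTerm_neg_mul_jacobiThetaQ hq (mul_ne_zero hd0 hs0) (n + 1)
    have h2 : (q : ℂ) ^ ((n : ℤ) + 1) * (d * s) = c * s := by
      rw [hd, ← mul_assoc, ← mul_assoc, ← zpow_add₀ hqc, add_neg_cancel, zpow_zero, one_mul]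
    rw [h2, hd, mul_assoc _ c, thetaTerm_mul] at h1
    have h3 : ((q : ℂ) ^ (-((n : ℤ) + 1))) ^ (-((n : ℤ) + 1)) *
        thetaTerm (q : ℂ) (c * s) (-((n : ℤ) + 1)) =
        (q : ℂ) ^ (n * (n + 1) / 2) / (c ^ (n + 1) * s ^ (n + 1)) := by
      have e : ((n : ℤ) + 1) * (n + 1) - (-((n : ℤ) + 1)) * (-((n : ℤ) + 1) - 1) / 2
          = ((n * (n + 1) / 2 : ℕ) : ℤ) := by
        have e1 := two_mul_triangular (-((n : ℤ) + 1))
        have e2 := two_mul_triangular_nat (n + 1)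
        rw [Nat.add_sub_cancel, mul_comm (n + 1) n] at e2
        push_cast at e2 ⊢
        linarith
      rw [thetaTerm, ← zpow_mul, ← zpow_natCast _ (n * (n + 1) / 2), ← e, zpow_sub₀ hqc,
        ← mul_pow, ← zpow_natCast (c * s), zpow_neg (c * s)]
      push_cast
      rw [neg_mul_neg]
      field_simp
    rw [h3] at h1
    rw [hd, mul_assoc _ c, ← h1]
    field_simp
    ring
  · refine Summable.mul_right _ ?_
    exact (summable_thetaTerm_neg hq hdn).add (summable_thetaTerm_neg hq (mul_pos hdn hq0))
  · intro j s hs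
    have hs0 : 0 < s := zero_lt_one.trans_le hs.1
    rw [hterm j s hs, norm_mul, norm_thetaTerm hq0]
    refine mul_le_mul ?_ (hM s hs) (norm_nonneg _) ?_
    · refine thetaTerm_le_add hq0 hdn ?_ ?_ _
      · rw [norm_mul, Complex.norm_real, Real.norm_of_nonneg hs0.le]
        exact le_mul_of_one_le_right hdn.le hs.1
      · rw [norm_mul, Complex.norm_real, Real.norm_of_nonneg hs0.le]
        exact mul_le_mul_of_nonneg_left hs.2 hdn.le
    · exact add_nonneg (thetaTerm_nonneg hq0 hdn.le _)
        (thetaTerm_nonneg hq0 (mul_pos hdn hq0).le _)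
  · intro s hs
    have hs0 : (s : ℂ) ≠ 0 := by exact_mod_cast (zero_lt_one.trans_le hs.1).ne'
    simp only [hterm _ s hs]
    refine HasSum.mul_right _ ?_
    exact hasSum_thetaTerm_neg hq (mul_ne_zero hd0 hs0)

end Unfolding

/-! ### The ray integral as a Cauchy kernel -/

section Kernel

/-- Tonelli bounds the `L¹` norm of the sum by the sum of the `L¹` norms. This gives absolute
convergence of the ray integral. -/
theorem integrable_of_hasSum_of_summable_integral_norm {α : Type*} [MeasurableSpace α]
    {μ : Measure α} {F : ℕ → α → ℂ} {g : α → ℂ} (hF : ∀ n, Integrable (F n) μ)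
    (hs : Summable fun n => ∫ a, ‖F n a‖ ∂μ) (hg : ∀ᵐ a ∂μ, HasSum (fun n => F n a) (g a)) :
    Integrable g μ := by
  have hmeas : AEStronglyMeasurable g μ := by
    refine aestronglyMeasurable_of_tendsto_ae atTop
      (f := fun N a => ∑ n ∈ Finset.range N, F n a) (fun N => ?_) ?_
    · exact Finset.aestronglyMeasurable_fun_sum _ fun n _ => (hF n).1
    · filter_upwards [hg] with a ha using ha.tendsto_sum_nat
  refine ⟨hmeas, ?_⟩
  have h1 : ∫⁻ a, ‖g a‖ₑ ∂μ ≤ ∫⁻ a, ∑' n, ‖F n a‖ₑ ∂μ := by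
    refine lintegral_mono_ae ?_
    filter_upwards [hg] with a ha
    rw [← ha.tsum_eq]
    exact enorm_tsum_le_tsum_enorm
  rw [lintegral_tsum fun n => (hF n).1.enorm] at h1
  refine h1.trans_lt ?_
  have h2 : ∀ n, ∫⁻ a, ‖F n a‖ₑ ∂μ = ENNReal.ofReal (∫ a, ‖F n a‖ ∂μ) := fun n =>
    (ofReal_integral_norm_eq_lintegral_enorm (hF n)).symm
  simp only [h2]
  rw [← ENNReal.ofReal_tsum_of_nonneg (fun n => integral_nonneg fun _ => norm_nonneg _) hs]
  exact ENNReal.ofReal_lt_top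

theorem hasSum_qExpE {q : ℝ} (hq : 1 < q) (z : ℂ) :
    HasSum (fun n : ℕ => z ^ n / (q : ℂ) ^ (n * (n - 1) / 2)) (qExpE q z) := by
  rw [qExpE]
  refine Summable.hasSum ?_
  rcases eq_or_ne z 0 with rfl | hz
  · refine summable_of_ne_finset_zero (s := {0}) fun n hn => ?_
    rw [zero_pow (by simpa using hn), zero_div]
  · simp only [← thetaTerm_natCast]
    refine Summable.of_norm ?_
    simp only [norm_thetaTerm (zero_lt_one.trans hq)]
    exact summable_thetaTerm_nat hq (norm_pos_iff.2 hz)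

section Moments

variable {q : ℝ} {c : ℂ}

theorem continuousOn_inv_jacobiThetaQ_ray (hq : 1 < q)
    (hc : ∀ t : ℝ, 0 < t → c * t ≠ 0 ∧ jacobiThetaQ q (c * t) ≠ 0) :
    ContinuousOn (fun t : ℝ => (jacobiThetaQ q (c * t))⁻¹) (Set.Ioi 0) :=
  ((continuousOn_jacobiThetaQ hq).comp (Continuous.continuousOn (by fun_prop))
    fun t ht => (hc t ht).1).inv₀ fun t ht => (hc t ht).2

theorem inv_jacobiThetaQ_zpow_mul (hq : 1 < q) {z : ℂ} (hz : z ≠ 0) (j : ℤ) :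
    (jacobiThetaQ q ((q : ℂ) ^ j * z))⁻¹ = thetaTerm (q : ℂ) z (-j) * (jacobiThetaQ q z)⁻¹ := by
  have h0 := thetaTerm_ne_zero (q := (q : ℂ)) (by exact_mod_cast (zero_lt_one.trans hq).ne') hz (-j)
  rw [← thetaTerm_neg_mul_jacobiThetaQ hq hz j, mul_inv, mul_inv_cancel_left₀ h0]

/-- With `W = 1 / Θ(c t)` the integrand over the period collapses to `1 / s`. -/
theorem integral_pow_mul_inv_jacobiThetaQ (hq : 1 < q) (hc0 : c ≠ 0)
    (hc : ∀ t : ℝ, 0 < t → c * t ≠ 0 ∧ jacobiThetaQ q (c * t) ≠ 0) (n : ℕ) :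
    IntegrableOn (fun t : ℝ => (t : ℂ) ^ n * (jacobiThetaQ q (c * t))⁻¹) (Set.Ioi 0) ∧
      ∫ t in Set.Ioi (0 : ℝ), (t : ℂ) ^ n * (jacobiThetaQ q (c * t))⁻¹ =
        (q : ℂ) ^ (n * (n + 1) / 2) / c ^ (n + 1) * Real.log q := by
  have key := integral_pow_mul_of_quasiPeriodic hq hc0 (continuousOn_inv_jacobiThetaQ_ray hq hc)
    (fun j t ht => by
      rw [← inv_jacobiThetaQ_zpow_mul hq (hc t ht).1]
      push_cast
      rw [mul_left_comm]) n
  refine ⟨key.1, key.2.trans ?_⟩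
  congr 1
  have h : ∫ s in (1 : ℝ)..q, jacobiThetaQ q (c * s) * (jacobiThetaQ q (c * s))⁻¹ / s =
      ∫ s in (1 : ℝ)..q, ((s⁻¹ : ℝ) : ℂ) := by
    refine intervalIntegral.integral_congr fun s hs => ?_
    rw [Set.uIcc_of_le hq.le] at hs
    rw [mul_inv_cancel₀ (hc s (zero_lt_one.trans_le hs.1)).2]
    push_cast
    rw [one_div]
  rw [h, intervalIntegral.integral_ofReal, integral_inv_of_pos one_pos (zero_lt_one.trans hq),
    div_one]

/-- `|1 / Θ(c t)|` is quasi-periodic with `c` replaced by `|c|`, so the absolute moments depend on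
`n` exactly as the moments do, up to one constant. Termwise integration rests on this. -/
theorem exists_integral_norm_pow_mul_inv_jacobiThetaQ (hq : 1 < q) (hc0 : c ≠ 0)
    (hc : ∀ t : ℝ, 0 < t → c * t ≠ 0 ∧ jacobiThetaQ q (c * t) ≠ 0) :
    ∃ B : ℝ, ∀ n : ℕ, ∫ t in Set.Ioi (0 : ℝ), ‖(t : ℂ) ^ n * (jacobiThetaQ q (c * t))⁻¹‖ =
      q ^ (n * (n + 1) / 2) / ‖c‖ ^ (n + 1) * B := by
  have hq0 := zero_lt_one.trans hq
  have hcn : (‖c‖ : ℂ) ≠ 0 := by exact_mod_cast (norm_pos_iff.2 hc0).ne'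
  have key := integral_pow_mul_of_quasiPeriodic hq hcn
    (W := fun t : ℝ => ((‖(jacobiThetaQ q (c * t))⁻¹‖ : ℝ) : ℂ))
    (Complex.continuous_ofReal.comp_continuousOn (continuousOn_inv_jacobiThetaQ_ray hq hc).norm)
    (fun j t ht => by
      have : c * ((q ^ j * t : ℝ) : ℂ) = (q : ℂ) ^ j * (c * t) := by
        push_cast
        ring
      rw [this, inv_jacobiThetaQ_zpow_mul hq (hc t ht).1, norm_mul, norm_thetaTerm hq0, norm_mul,
        Complex.norm_real, Real.norm_of_nonneg ht.le, Complex.ofReal_mul, ofReal_thetaTerm,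
        Complex.ofReal_mul])
  refine ⟨‖∫ s in (1 : ℝ)..q,
    jacobiThetaQ q ((‖c‖ : ℂ) * s) * ((‖(jacobiThetaQ q (c * s))⁻¹‖ : ℝ) : ℂ) / s‖, fun n => ?_⟩
  have h1 : ((∫ t in Set.Ioi (0 : ℝ), ‖(t : ℂ) ^ n * (jacobiThetaQ q (c * t))⁻¹‖ : ℝ) : ℂ) =
      ∫ t in Set.Ioi (0 : ℝ), (t : ℂ) ^ n * ((‖(jacobiThetaQ q (c * t))⁻¹‖ : ℝ) : ℂ) := by
    rw [← integral_complex_ofReal]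
    refine setIntegral_congr_fun measurableSet_Ioi fun t ht => ?_
    rw [norm_mul, norm_pow, Complex.norm_real, Real.norm_of_nonneg (le_of_lt ht)]
    push_cast
    rfl
  rw [(key n).2] at h1
  have h2 := congrArg norm h1
  rw [Complex.norm_real, Real.norm_of_nonneg (integral_nonneg fun _ => norm_nonneg _)] at h2
  rw [h2, norm_mul, norm_div, norm_pow, norm_pow, Complex.norm_real, Complex.norm_real, norm_norm,
    Real.norm_of_nonneg hq0.le]

end Moments

/-- The quadratic parts in `n` of the two triangular exponents cancel, leaving a geometric
progression. Stated over any field, to serve both the complex values and the real norms. -/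
theorem mul_ray_moment_eq_geometric {K : Type*} [Field K] {q w : K} (hq : q ≠ 0) (hw : w ≠ 0)
    (z : K) (n k : ℕ) :
    z ^ n / q ^ (n * (n - 1) / 2) * (q ^ ((n + k) * (n + k + 1) / 2) / (q * w) ^ (n + k + 1)) =
      q ^ (k * (k - 1) / 2) / (q * w ^ (k + 1)) * (q ^ k * z / w) ^ n := by
  have h : (n + k) * (n + k + 1) / 2 + 1 =
      n * (n - 1) / 2 + n * k + k * (k - 1) / 2 + (n + k + 1) := by
    have h1 := two_mul_triangular_nat (n + k + 1)
    have h2 := two_mul_triangular_nat n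
    have h3 := two_mul_triangular_nat k
    rw [Nat.add_sub_cancel, mul_comm (n + k + 1)] at h1
    generalize (n + k) * (n + k + 1) / 2 = A at h1 ⊢
    generalize n * (n - 1) / 2 = B at h2 ⊢
    generalize k * (k - 1) / 2 = C at h3 ⊢
    zify
    push_cast at h1
    linarith
  have h' : q ^ ((n + k) * (n + k + 1) / 2) * q =
      q ^ (n * (n - 1) / 2) * (q ^ k) ^ n * q ^ (k * (k - 1) / 2) * q ^ (n + k + 1) := by
    rw [← pow_succ, h, pow_add, pow_add, pow_add, mul_comm n k, pow_mul]
  rw [mul_pow q w, div_pow, mul_pow _ z]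
  have a1 : q ^ (n * (n - 1) / 2) ≠ 0 := pow_ne_zero _ hq
  have a2 : q ^ (n + k + 1) ≠ 0 := pow_ne_zero _ hq
  have a3 : w ^ (n + k + 1) = w ^ (k + 1) * w ^ n := by ring
  rw [a3, div_mul_div_comm, div_mul_div_comm, div_eq_div_iff
    (mul_ne_zero a1 (mul_ne_zero a2 (mul_ne_zero (pow_ne_zero _ hw) (pow_ne_zero _ hw))))
    (mul_ne_zero (mul_ne_zero hq (pow_ne_zero _ hw)) (pow_ne_zero _ hw))]
  linear_combination (z ^ n * w ^ (k + 1) * w ^ n) * h'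

theorem AdmissibleDirection.ne_neg {ω : ℂ} {θ : ℝ} (h : AdmissibleDirection ω θ) (hω : ω ≠ 0)
    {s x : ℝ} (hs : 0 < s) (hx : 0 < x) : ω * Complex.exp (θ * Complex.I) * s ≠ -x := by
  intro heq
  rw [← Complex.norm_mul_exp_arg_mul_I ω, mul_assoc (‖ω‖ : ℂ), ← Complex.exp_add] at heq
  have hω' := norm_pos_iff.2 hω
  have h1 := congrArg norm heq
  rw [norm_mul, norm_mul, ← add_mul, ← Complex.ofReal_add, Complex.norm_exp_ofReal_mul_I, norm_neg,
    Complex.norm_real, Complex.norm_real, Complex.norm_real, norm_norm, mul_one,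
    Real.norm_of_nonneg hs.le, Real.norm_of_nonneg hx.le] at h1
  have h2 : Complex.exp (((Complex.arg ω + θ : ℝ) : ℂ) * Complex.I) =
      Complex.exp (Real.pi * Complex.I) := by
    rw [Complex.exp_pi_mul_I]
    rw [← h1, ← add_mul, ← Complex.ofReal_add] at heq
    have hne : ((‖ω‖ * s : ℝ) : ℂ) ≠ 0 := by exact_mod_cast (mul_pos hω' hs).ne'
    apply mul_left_cancel₀ hne
    push_cast at heq ⊢
    linear_combination heq
  obtain ⟨n, hn⟩ := Complex.exp_eq_exp_iff_exists_int.1 h2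
  refine h n ?_
  have h3 : ((Complex.arg ω + θ : ℝ) : ℂ) = (((2 * n + 1) * Real.pi : ℝ) : ℂ) := by
    apply mul_right_cancel₀ Complex.I_ne_zero
    rw [hn]
    push_cast
    ring
  exact_mod_cast h3

/-- The inner integral of the kernel is a Cauchy kernel. -/
theorem rayIntegral_qKernel {q : ℝ} (hq : 1 < q) (k : ℕ) {z ω : ℂ} {θ : ℝ}
    (hz : q ^ k * ‖z‖ < ‖ω‖) (hθ : AdmissibleDirection ω θ) :
    RayIntegrable θ (qKernel q k z ω) ∧
      rayIntegral θ (qKernel q k z ω) =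
        (q : ℂ) ^ (k * (k - 1) / 2) * Real.log q / q * ((ω ^ k)⁻¹ * (ω - (q : ℂ) ^ k * z)⁻¹) := by
  have hq0 := zero_lt_one.trans hq
  have hqc : (q : ℂ) ≠ 0 := by exact_mod_cast hq0.ne'
  have hω' : 0 < ‖ω‖ := lt_of_le_of_lt (by positivity) hz
  have hω : ω ≠ 0 := norm_pos_iff.1 hω'
  obtain ⟨e, he⟩ : ∃ e : ℂ, e = Complex.exp (θ * Complex.I) := ⟨_, rfl⟩
  have he0 : e ≠ 0 := he ▸ Complex.exp_ne_zero _
  have hen : ‖e‖ = 1 := he ▸ Complex.norm_exp_ofReal_mul_I θ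
  obtain ⟨c, hcdef⟩ : ∃ c : ℂ, c = q * (ω * e) := ⟨_, rfl⟩
  have hc0 : c ≠ 0 := hcdef ▸ mul_ne_zero hqc (mul_ne_zero hω he0)
  have hcn : ‖c‖ = q * ‖ω‖ := by
    rw [hcdef, norm_mul, norm_mul, hen, mul_one, Complex.norm_real, Real.norm_of_nonneg hq0.le]
  have hc : ∀ t : ℝ, 0 < t → c * t ≠ 0 ∧ jacobiThetaQ q (c * t) ≠ 0 := by
    intro t ht
    have h0 : c * t ≠ 0 := mul_ne_zero hc0 (by exact_mod_cast ht.ne')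
    refine ⟨h0, jacobiThetaQ_ne_zero hq h0 fun x hx h => ?_⟩
    refine hθ.ne_neg hω (mul_pos hq0 ht) hx ?_
    rw [← h, hcdef, he]
    push_cast
    ring
  -- The power of `e` collects `n` factors from `(zζ)^n`, `k` from `ζ^k` and one from `dζ`.
  set a : ℕ → ℂ := fun n => z ^ n / (q : ℂ) ^ (n * (n - 1) / 2) * e ^ (n + k + 1) with ha
  set F : ℕ → ℝ → ℂ := fun n t => a n * ((t : ℂ) ^ (n + k) * (jacobiThetaQ q (c * t))⁻¹) with hF
  have hint : ∀ n, IntegrableOn (F n) (Set.Ioi 0) := fun n =>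
    (integral_pow_mul_inv_jacobiThetaQ hq hc0 hc (n + k)).1.const_mul (a n)
  obtain ⟨B, hB⟩ := exists_integral_norm_pow_mul_inv_jacobiThetaQ hq hc0 hc
  have hnorm : ∀ n, ∫ t in Set.Ioi (0 : ℝ), ‖F n t‖ =
      q ^ (k * (k - 1) / 2) / (q * ‖ω‖ ^ (k + 1)) * (q ^ k * ‖z‖ / ‖ω‖) ^ n * B := by
    intro n
    simp only [hF, norm_mul (a n), integral_const_mul, hB]
    rw [← mul_ray_moment_eq_geometric hq0.ne' hω'.ne', ha, hcn]
    simp only [norm_mul, norm_div, norm_pow, hen, Complex.norm_real, Real.norm_of_nonneg hq0.le,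
      one_pow, mul_one]
    ring
  have hratio : q ^ k * ‖z‖ / ‖ω‖ < 1 := (div_lt_one hω').2 hz
  have hsumm : Summable fun n => ∫ t in Set.Ioi (0 : ℝ), ‖F n t‖ := by
    simp only [hnorm]
    exact ((summable_geometric_of_lt_one (by positivity) hratio).mul_left _).mul_right _
  have hpoint : ∀ t : ℝ, HasSum (fun n => F n t) (qKernel q k z ω (t * e) * e) := by
    intro t
    have h1 := (hasSum_qExpE hq (z * (t * e))).mul_right
      ((t * e) ^ k * (jacobiThetaQ q (c * t))⁻¹ * e)
    have h2 : qExpE q (z * (t * e)) * ((t * e) ^ k * (jacobiThetaQ q (c * t))⁻¹ * e) =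
        qKernel q k z ω (t * e) * e := by
      have : (q : ℂ) * ω * (t * e) = c * t := by
        rw [hcdef]
        ring
      rw [qKernel, this]
      ring
    rw [h2] at h1
    refine h1.congr_fun ?_
    intro n
    simp only [hF, ha, mul_pow]
    ring
  have hval : ∀ n, ∫ t in Set.Ioi (0 : ℝ), F n t =
      (q : ℂ) ^ (k * (k - 1) / 2) / (q * ω ^ (k + 1)) * ((q : ℂ) ^ k * z / ω) ^ n * Real.log q := by
    intro n
    simp only [hF, integral_const_mul, (integral_pow_mul_inv_jacobiThetaQ hq hc0 hc (n + k)).2]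
    rw [← mul_ray_moment_eq_geometric hqc hω, ha, hcdef, ← mul_assoc (q : ℂ) ω e, mul_pow _ e]
    have := pow_ne_zero (n + k + 1) he0
    field_simp
  have hS := hasSum_integral_of_summable_integral_norm hint hsumm
  simp only [hval, (hpoint _).tsum_eq] at hS
  have hratio' : ‖(q : ℂ) ^ k * z / ω‖ < 1 := by
    rwa [norm_div, norm_mul, norm_pow, Complex.norm_real, Real.norm_of_nonneg hq0.le]
  have hgeo := ((hasSum_geometric_of_norm_lt_one hratio').mul_left
    ((q : ℂ) ^ (k * (k - 1) / 2) / (q * ω ^ (k + 1)))).mul_right (Real.log q : ℂ)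
  constructor
  · rw [RayIntegrable, ← he]
    exact integrable_of_hasSum_of_summable_integral_norm hint hsumm
      (Eventually.of_forall hpoint)
  · rw [rayIntegral, ← he, hS.unique hgeo]
    have hne : ω - (q : ℂ) ^ k * z ≠ 0 := by
      intro h
      rw [← sub_eq_zero.1 h, div_self hω, norm_one] at hratio'
      exact lt_irrefl _ hratio'
    have : 1 - (q : ℂ) ^ k * z / ω = (ω - (q : ℂ) ^ k * z) / ω := by
      field_simp
    rw [this]
    field_simp
    ring

end Kernel

/-! ### Moment derivatives, difference quotients and Cauchy's formula -/

section MomentDerivative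

theorem mOne_succ_div {q : ℝ} (hq : q ≠ 0) (n : ℕ) : mOne q (n + 1) / mOne q n = q ^ n := by
  have h : (n + 1) * (n + 1 - 1) / 2 = n * (n - 1) / 2 + n := by
    rw [← Nat.choose_two_right, ← Nat.choose_two_right, Nat.choose_succ_succ' n 1,
      Nat.choose_one_right, add_comm]
  rw [mOne, mOne, h, pow_add, mul_div_cancel_left₀ _ (pow_ne_zero _ hq)]

theorem coeff_momentDeriv_mOne {q : ℝ} (hq : q ≠ 0) (φ : PowerSeries ℂ) (n : ℕ) :
    PowerSeries.coeff n (momentDeriv (mOne q) φ) = (q : ℂ) ^ n * PowerSeries.coeff (n + 1) φ := by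
  rw [momentDeriv, PowerSeries.coeff_mk, mOne_succ_div hq, Complex.ofReal_pow]

/-- The `k` steps contribute `q^n · q^(n+1) ⋯ q^(n+k-1)`. -/
theorem coeff_iterate_momentDeriv_mOne {q : ℝ} (hq : q ≠ 0) (φ : PowerSeries ℂ) (k n : ℕ) :
    PowerSeries.coeff n ((momentDeriv (mOne q))^[k] φ) =
      (q : ℂ) ^ (k * (k - 1) / 2) * ((q : ℂ) ^ k) ^ n * PowerSeries.coeff (n + k) φ := by
  induction k generalizing n with
  | zero => simp
  | succ k ih =>
    have h : (k + 1) * (k + 1 - 1) / 2 = k * (k - 1) / 2 + k := by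
      rw [← Nat.choose_two_right, ← Nat.choose_two_right, Nat.choose_succ_succ' k 1,
        Nat.choose_one_right, add_comm]
    rw [Function.iterate_succ_apply', coeff_momentDeriv_mOne hq, ih, h,
      show n + 1 + k = n + (k + 1) by ring]
    ring

theorem deriv_zero_eq_coeff_one {g : ℂ → ℂ} {φ : PowerSeries ℂ} {R : ℝ} (hR : 0 < R)
    (hg : ∀ z : ℂ, ‖z‖ < R → HasSum (fun n => PowerSeries.coeff n φ * z ^ n) (g z)) :
    deriv g 0 = PowerSeries.coeff 1 φ := by
  have h : HasFPowerSeriesAt g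
      (FormalMultilinearSeries.ofScalars ℂ fun n => PowerSeries.coeff n φ) 0 := by
    rw [hasFPowerSeriesAt_iff]
    filter_upwards [Metric.ball_mem_nhds (0 : ℂ) hR] with z hz
    rw [zero_add]
    refine (hg z (by simpa using hz)).congr_fun fun n => ?_
    rw [FormalMultilinearSeries.coeff_ofScalars, smul_eq_mul, mul_comm]
  rw [h.deriv]
  simp [FormalMultilinearSeries.ofScalars]

/-- Dropping the constant term of the series at `qz` and dividing by `qz` leaves `∑ q^n a_(n+1)
z^n`. Evaluating at `qz` divides the radius by `q`. -/
theorem hasSum_tildeD {q : ℝ} (hq : 1 < q) {g : ℂ → ℂ} {φ : PowerSeries ℂ} {R : ℝ}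
    (hg : ∀ z : ℂ, ‖z‖ < R → HasSum (fun n => PowerSeries.coeff n φ * z ^ n) (g z)) {z : ℂ}
    (hz : q * ‖z‖ < R) :
    HasSum (fun n => PowerSeries.coeff n (momentDeriv (mOne q) φ) * z ^ n) (tildeD q g z) := by
  have hq0 := zero_lt_one.trans hq
  have hqc : (q : ℂ) ≠ 0 := by exact_mod_cast hq0.ne'
  have hR : 0 < R := lt_of_le_of_lt (by positivity) hz
  simp only [coeff_momentDeriv_mOne hq0.ne']
  rcases eq_or_ne z 0 with rfl | hz0
  · rw [tildeD, if_pos rfl, deriv_zero_eq_coeff_one hR hg]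
    convert! hasSum_single (f := fun n => (q : ℂ) ^ n * PowerSeries.coeff (n + 1) φ * 0 ^ n) 0
      fun n hn => ?_
    · simp
    · simp [hn]
  · rw [tildeD, if_neg hz0]
    have h0 : g 0 = PowerSeries.coeff 0 φ := by
      refine (hg 0 (by simpa using hR)).unique ?_
      convert! hasSum_single (f := fun n => PowerSeries.coeff n φ * (0 : ℂ) ^ n) 0 fun n hn => ?_
      · simp
      · simp [hn]
    have h1 := hg (q * z) (by
      rwa [norm_mul, Complex.norm_real, Real.norm_of_nonneg hq0.le])
    rw [← hasSum_nat_add_iff' 1] at h1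
    simp only [Finset.range_one, Finset.sum_singleton, pow_zero, mul_one, ← h0] at h1
    refine (h1.div_const ((q : ℂ) * z)).congr_fun fun n => ?_
    field_simp
    ring

theorem hasSum_iterate_tildeD {q : ℝ} (hq : 1 < q) {g : ℂ → ℂ} {φ : PowerSeries ℂ} {R : ℝ}
    (hg : ∀ z : ℂ, ‖z‖ < R → HasSum (fun n => PowerSeries.coeff n φ * z ^ n) (g z)) (k : ℕ)
    {z : ℂ} (hz : q ^ k * ‖z‖ < R) :
    HasSum (fun n => PowerSeries.coeff n ((momentDeriv (mOne q))^[k] φ) * z ^ n)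
      ((tildeD q)^[k] g z) := by
  have hq0 := zero_lt_one.trans hq
  induction k generalizing z with
  | zero => exact hg z (by simpa using hz)
  | succ k ih =>
    rw [Function.iterate_succ_apply', Function.iterate_succ_apply']
    refine hasSum_tildeD hq (R := R / q ^ k) (fun w hw => ih ?_) ?_
    · rwa [lt_div_iff₀ (pow_pos hq0 k), mul_comm] at hw
    · rw [lt_div_iff₀ (pow_pos hq0 k)]
      calc q * ‖z‖ * q ^ k = q ^ (k + 1) * ‖z‖ := by ring
        _ < R := hz

theorem pqDeriv_zero_left (q : ℝ) : pqDeriv 0 q = tildeD q := by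
  funext f z
  rw [pqDeriv, tildeD, Complex.ofReal_zero, zero_mul, zero_sub, ← neg_sub (f (q * z)) (f 0),
    neg_div_neg_eq]

theorem hasSum_maclaurin {f : ℂ → ℂ} {r : ℝ} (hf : DifferentiableOn ℂ f (Metric.ball 0 r)) {z : ℂ}
    (hz : ‖z‖ < r) : HasSum (fun n => PowerSeries.coeff n (maclaurin f) * z ^ n) (f z) := by
  refine (Complex.hasSum_taylorSeries_on_ball hf (z := z) (by simpa using hz)).congr_fun fun n => ?_
  rw [maclaurin, PowerSeries.coeff_mk, sub_zero, smul_eq_mul, smul_eq_mul]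
  ring

theorem coeff_maclaurin_eq_circleIntegral {f : ℂ → ℂ} {ε : ℝ} (hε : 0 < ε)
    (hf : DifferentiableOn ℂ f (Metric.closedBall 0 ε)) (n : ℕ) :
    PowerSeries.coeff n (maclaurin f) =
      (2 * Real.pi * Complex.I : ℂ)⁻¹ * ∮ ω in C(0, ε), (ω ^ (n + 1))⁻¹ * f ω := by
  have h := hf.circleIntegral_one_div_sub_center_pow_smul hε n
  simp only [sub_zero, one_div, smul_eq_mul] at h
  rw [h, maclaurin, PowerSeries.coeff_mk]
  have := Complex.two_pi_I_ne_zero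
  field_simp

/-- The Cauchy integral of `f ω / ω ^ k` sums the shifted Maclaurin series of `f`. -/
theorem hasSum_coeff_add_maclaurin {f : ℂ → ℂ} {ε : ℝ} (hε : 0 < ε)
    (hf : DifferentiableOn ℂ f (Metric.closedBall 0 ε)) (k : ℕ) {w : ℂ} (hw : ‖w‖ < ε) :
    HasSum (fun n => PowerSeries.coeff (n + k) (maclaurin f) * w ^ n)
      ((2 * Real.pi * Complex.I : ℂ)⁻¹ * ∮ ω in C(0, ε), f ω * ((ω ^ k)⁻¹ * (ω - w)⁻¹)) := by
  have hne : ∀ ω ∈ Metric.sphere (0 : ℂ) ε, ω ≠ 0 := fun ω hω =>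
    norm_pos_iff.1 (by rw [mem_sphere_zero_iff_norm.1 hω]; exact hε)
  have hcont : ContinuousOn (fun ω => (ω ^ k)⁻¹ * f ω) (Metric.sphere 0 ε) :=
    ((continuousOn_pow k).inv₀ fun ω hω => pow_ne_zero _ (hne ω hω)).mul
      (hf.continuousOn.mono Metric.sphere_subset_closedBall)
  -- `f ω / ω^k` may have a pole at `0`, but expanding its Cauchy integral only needs continuity on
  -- the circle.
  have h := hasSum_cauchyPowerSeries_integral (hcont.circleIntegrable hε.le) hw
  simp only [cauchyPowerSeries_apply, smul_eq_mul, zero_add, sub_zero] at h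
  convert! h using 1
  · funext n
    rw [coeff_maclaurin_eq_circleIntegral hε hf, mul_assoc, mul_comm _ (w ^ n),
      ← circleIntegral.integral_const_mul]
    congr 1
    refine circleIntegral.integral_congr hε.le fun ω hω => ?_
    have := hne ω hω
    simp only [div_pow]
    field_simp
    ring
  · congr 1
    refine circleIntegral.integral_congr hε.le fun ω hω => ?_
    ring

end MomentDerivative

/-! ### Existence of an admissible exponent -/

section Growth

/-- The exponent `1 / 2` is admissible. -/
theorem isGrowthExponent_half {q : ℝ} (hq : 1 < q) : IsGrowthExponent q (1 / 2) := by
  have hq0 := zero_lt_one.trans hq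
  have hL := Real.log_pos hq
  have hS1 := summable_thetaTerm hq one_pos
  have hSq := summable_thetaTerm hq hq0
  refine ⟨∑' m : ℤ, (thetaTerm q 1 m + thetaTerm q q m), ?_, fun z hz => ?_⟩
  · refine (hS1.add hSq).tsum_pos (fun m => add_nonneg (thetaTerm_nonneg hq0 zero_le_one m)
      (thetaTerm_nonneg hq0 hq0.le m)) 0 ?_
    simp [thetaTerm]
  have hz' := norm_pos_iff.2 hz
  -- Write `|z| = q^j y` with `y` in one period: the theta series is bounded there, and
  -- quasi-periodicity carries all the growth.
  obtain ⟨j, hj⟩ := exists_mem_Ico_zpow hz' hq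
  have hqj : 0 < q ^ j := zpow_pos hq0 j
  obtain ⟨y, hy⟩ : ∃ y : ℝ, y = ‖z‖ / q ^ j := ⟨_, rfl⟩
  have hy1 : 1 ≤ y := by rw [hy, le_div_iff₀ hqj, one_mul]; exact hj.1
  have hyq : y ≤ q := by
    rw [hy, div_le_iff₀ hqj, mul_comm, ← zpow_add_one₀ hq0.ne']; exact hj.2.le
  have hy0 : 0 < y := zero_lt_one.trans_le hy1
  have hzy : ‖z‖ = q ^ j * y := by rw [hy]; field_simp
  have hE : ‖qExpE q z‖ ≤ ∑' m : ℤ, thetaTerm q ‖z‖ m := by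
    have hs := summable_thetaTerm hq hz'
    rw [qExpE_eq]
    refine (norm_tsum_le_tsum_norm ?_).trans ?_
    · simp only [norm_thetaTerm hq0]
      exact summable_thetaTerm_nat hq hz'
    · simp only [norm_thetaTerm hq0]
      exact tsum_comp_le_tsum_of_inj hs (thetaTerm_nonneg hq0 hz'.le) Nat.cast_injective
  have hshift : thetaTerm q y (-j) * ∑' m : ℤ, thetaTerm q ‖z‖ m = ∑' m : ℤ, thetaTerm q y m := by
    rw [hzy, ← tsum_mul_left]
    simp only [thetaTerm_neg_mul_shift hq0.ne' hy0.ne']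
    exact (Equiv.subRight j).tsum_eq fun m => thetaTerm q y m
  have hbound : ∑' m : ℤ, thetaTerm q y m ≤ ∑' m : ℤ, (thetaTerm q 1 m + thetaTerm q q m) :=
    (summable_thetaTerm hq hy0).tsum_le_tsum (thetaTerm_le_add hq0 one_pos hy1 hyq)
      (hS1.add hSq)
  have hK : 0 ≤ ∑' m : ℤ, (thetaTerm q 1 m + thetaTerm q q m) :=
    tsum_nonneg fun m => add_nonneg (thetaTerm_nonneg hq0 zero_le_one m)
      (thetaTerm_nonneg hq0 hq0.le m)
  have hpos : 0 < thetaTerm q y (-j) := by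
    unfold thetaTerm
    positivity
  have hinv : (thetaTerm q y (-j))⁻¹ ≤
      Real.exp (Real.log ‖z‖ ^ 2 / (2 * Real.log q)) * ‖z‖ ^ (1 / 2 : ℝ) := by
    rw [Real.rpow_def_of_pos hz', ← Real.exp_add, ← Real.log_le_iff_le_exp (inv_pos.2 hpos),
      Real.log_inv, thetaTerm, Real.log_div (zpow_ne_zero _ hy0.ne') (zpow_ne_zero _ hq0.ne'),
      Real.log_zpow, Real.log_zpow, hzy, Real.log_mul hqj.ne' hy0.ne', Real.log_zpow]
    have htri : (((-j) * (-j - 1) / 2 : ℤ) : ℝ) = j * (j + 1) / 2 := by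
      have h : (2 : ℝ) * (((-j) * (-j - 1) / 2 : ℤ) : ℝ) = (-j) * (-j - 1) := by
        exact_mod_cast two_mul_triangular (-j)
      linarith
    rw [htri]
    have hl := Real.log_nonneg hy1
    -- The left side is `j log y + j(j+1)/2 · log q`. The square supplies `j² log q / 2`, the
    -- exponent `1/2` supplies `j log q / 2`, and the surplus is nonnegative since `y ≥ 1`.
    have hid : (j * Real.log q + Real.log y) ^ 2 / (2 * Real.log q) =
        j ^ 2 * Real.log q / 2 + j * Real.log y + Real.log y ^ 2 / (2 * Real.log q) := by
      field_simp
      ring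
    have hnn : 0 ≤ Real.log y ^ 2 / (2 * Real.log q) := by positivity
    rw [hid]
    push_cast
    nlinarith
  calc ‖qExpE q z‖ ≤ ∑' m : ℤ, thetaTerm q ‖z‖ m := hE
    _ = (∑' m : ℤ, thetaTerm q y m) * (thetaTerm q y (-j))⁻¹ := by
      rw [← hshift]
      field_simp
    _ ≤ _ := by
      rw [mul_assoc]
      exact mul_le_mul hbound hinv (inv_pos.2 hpos).le hK

end Growth

/-! ### The contour integral -/

section Representation

/-- The integrand of the representation agrees with a Cauchy integrand almost everywhere on the
circle. -/
theorem ae_circleMap_rayIntegral_eq {q : ℝ} (hq : 1 < q) {ε : ℝ} (hε : 0 < ε) (k : ℕ) {z : ℂ}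
    (hz : q ^ k * ‖z‖ < ε) (f : ℂ → ℂ) {θ : ℂ → ℝ}
    (hθ : {ω : ℂ | ‖ω‖ = ε ∧ ¬ AdmissibleDirection ω (θ ω)}.Countable) :
    ∀ᵐ t : ℝ, f (circleMap 0 ε t) * rayIntegral (θ (circleMap 0 ε t))
        (qKernel q k z (circleMap 0 ε t)) =
      (q : ℂ) ^ (k * (k - 1) / 2) * Real.log q / q * (f (circleMap 0 ε t) *
        ((circleMap 0 ε t ^ k)⁻¹ * (circleMap 0 ε t - (q : ℂ) ^ k * z)⁻¹)) := by
  filter_upwards [(hθ.preimage_circleMap 0 hε.ne').ae_notMem volume] with t ht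
  have hn : ‖circleMap 0 ε t‖ = ε := by simp [abs_of_pos hε]
  have had : AdmissibleDirection (circleMap 0 ε t) (θ (circleMap 0 ε t)) := by
    by_contra h
    exact ht ⟨hn, h⟩
  rw [(rayIntegral_qKernel hq k (by rwa [hn]) had).2]
  ring

/-- Off a countable set the integrand is a function continuous on the circle and independent of `θ`,
so integrability requires no regularity of `θ`. -/
theorem circleIntegrable_and_qIntegralRep_eq {q : ℝ} (hq : 1 < q) {ε : ℝ} (hε : 0 < ε) (k : ℕ)
    {z : ℂ} (hz : q ^ k * ‖z‖ < ε) {f : ℂ → ℂ} (hf : ContinuousOn f (Metric.sphere 0 ε))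
    {θ : ℂ → ℝ} (hθ : {ω : ℂ | ‖ω‖ = ε ∧ ¬ AdmissibleDirection ω (θ ω)}.Countable) :
    CircleIntegrable (fun ω => f ω * rayIntegral (θ ω) (qKernel q k z ω)) 0 ε ∧
      qIntegralRep q k ε θ f z = (q : ℂ) ^ (k * (k - 1) / 2) *
        ((2 * Real.pi * Complex.I : ℂ)⁻¹ *
          ∮ ω in C(0, ε), f ω * ((ω ^ k)⁻¹ * (ω - (q : ℂ) ^ k * z)⁻¹)) := by
  have hq0 := zero_lt_one.trans hq
  have hqc : (q : ℂ) ≠ 0 := by exact_mod_cast hq0.ne'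
  have hlog : (Real.log q : ℂ) ≠ 0 := by exact_mod_cast (Real.log_pos hq).ne'
  have hae := ae_circleMap_rayIntegral_eq hq hε k hz f hθ
  have hw : ‖(q : ℂ) ^ k * z‖ < ε := by
    rwa [norm_mul, norm_pow, Complex.norm_real, Real.norm_of_nonneg hq0.le]
  have hcont : ContinuousOn (fun ω => (q : ℂ) ^ (k * (k - 1) / 2) * Real.log q / q *
      (f ω * ((ω ^ k)⁻¹ * (ω - (q : ℂ) ^ k * z)⁻¹))) (Metric.sphere 0 ε) := by
    refine continuousOn_const.mul (hf.mul (ContinuousOn.mul ?_ ?_))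
    · refine (continuousOn_pow k).inv₀ fun ω hω => pow_ne_zero _ (norm_pos_iff.1 ?_)
      rwa [mem_sphere_zero_iff_norm.1 hω]
    · refine (continuousOn_id.sub continuousOn_const).inv₀ fun ω hω h => ?_
      have h1 : ω = (q : ℂ) ^ k * z := sub_eq_zero.1 h
      rw [← h1, mem_sphere_zero_iff_norm.1 hω] at hw
      exact lt_irrefl _ hw
  constructor
  · refine IntervalIntegrable.congr_ae (hcont.circleIntegrable hε.le) (ae_restrict_of_ae ?_)
    filter_upwards [hae] with t ht using ht.symm
  · have h : (∮ ω in C(0, ε), f ω * rayIntegral (θ ω) (qKernel q k z ω)) =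
        ∮ ω in C(0, ε), (q : ℂ) ^ (k * (k - 1) / 2) * Real.log q / q *
          (f ω * ((ω ^ k)⁻¹ * (ω - (q : ℂ) ^ k * z)⁻¹)) := by
      refine intervalIntegral.integral_congr_ae ?_
      filter_upwards [hae] with t ht _
      rw [ht]
    rw [qIntegralRep, h, circleIntegral.integral_const_mul]
    have hpi : (Real.pi : ℂ) ≠ 0 := by exact_mod_cast Real.pi_ne_zero
    have hI := Complex.I_ne_zero
    field_simp

end Representation

theorem theorem1 (q : ℝ) (hq : 1 < q) :
    (∃ α : ℝ, IsGrowthExponent q α) ∧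
    ∀ α : ℝ, IsGrowthExponent q α →
    ∀ (r : ℝ) (f : ℂ → ℂ), 0 < r → DifferentiableOn ℂ f (Metric.ball 0 r) →
    ∀ (ε : ℝ), 0 < ε → ε < r →
    ∀ (k : ℕ) (z : ℂ), ‖z‖ < (q ^ k)⁻¹ * ε * min 1 (q ^ (1 / 2 - α)) →
    ∀ θ : ℂ → ℝ,
      {ω : ℂ | ‖ω‖ = ε ∧ ¬ AdmissibleDirection ω (θ ω)}.Countable →
      (∀ ω : ℂ, ‖ω‖ = ε → AdmissibleDirection ω (θ ω) →
        RayIntegrable (θ ω) (qKernel q k z ω)) ∧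
      CircleIntegrable (fun ω => f ω * rayIntegral (θ ω) (qKernel q k z ω)) 0 ε ∧
      (tildeD q)^[k] f z = qIntegralRep q k ε θ f z ∧
      (pqDeriv 0 q)^[k] f z = qIntegralRep q k ε θ f z ∧
      HasSum
        (fun n : ℕ => PowerSeries.coeff n ((momentDeriv (mOne q))^[k] (maclaurin f)) * z ^ n)
        (qIntegralRep q k ε θ f z) := by
  refine ⟨⟨1 / 2, isGrowthExponent_half hq⟩, ?_⟩
  intro α _ r f _ hf ε hε hεr k z hz θ hθ
  have hq0 := zero_lt_one.trans hq
  have hz' : q ^ k * ‖z‖ < ε := by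
    have h1 : ‖z‖ < (q ^ k)⁻¹ * ε :=
      hz.trans_le (mul_le_of_le_one_right (by positivity) (min_le_left _ _))
    rwa [inv_mul_eq_div, lt_div_iff₀ (pow_pos hq0 k), mul_comm] at h1
  have hf' : DifferentiableOn ℂ f (Metric.closedBall 0 ε) :=
    hf.mono (Metric.closedBall_subset_ball hεr)
  obtain ⟨hint, hrep⟩ := circleIntegrable_and_qIntegralRep_eq hq hε k hz'
    (hf'.continuousOn.mono Metric.sphere_subset_closedBall) hθ
  have hsum : HasSum
      (fun n : ℕ => PowerSeries.coeff n ((momentDeriv (mOne q))^[k] (maclaurin f)) * z ^ n)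
      (qIntegralRep q k ε θ f z) := by
    rw [hrep]
    refine ((hasSum_coeff_add_maclaurin hε hf' k (w := (q : ℂ) ^ k * z) ?_).mul_left _).congr_fun
      fun n => ?_
    · rwa [norm_mul, norm_pow, Complex.norm_real, Real.norm_of_nonneg hq0.le]
    · rw [coeff_iterate_momentDeriv_mOne hq0.ne', mul_pow]
      ring
  -- Both sides sum the same power series at `z`.
  have htilde : (tildeD q)^[k] f z = qIntegralRep q k ε θ f z :=
    (hasSum_iterate_tildeD hq (fun w hw => hasSum_maclaurin hf hw) k (hz'.trans hεr)).unique hsum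
  refine ⟨fun ω hω hθω => (rayIntegral_qKernel hq k (by rwa [hω]) hθω).1, hint, htilde, ?_, hsum⟩
  rw [pqDeriv_zero_left, htilde]
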